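/- Let $k\ge 1$ be an integer. For $d>k$ let $\mathcal G_{k,d}$ be the Grassmann space of $k$-dimensional linear subspaces of Euclidean $\mathbb R^d$, write $P_V$ for the orthogonal projector onto $V\in\mathcal G_{k,d}$, and let $\sigma_k$ be the probability measure on $\mathcal G_{k,d}$ induced by the Haar measure on the orthogonal group $O(\mathbb R^d)$, i.e. the law of $gV_0$ where $g\in O(\mathbb R^d)$ is Haar-distributed and $V_0=\operatorname{span}(e_1,\dots,e_k)$. There is a constant $u_k>0$, depending only on $k$, such that for every integer $d>k$, every $t\in[-1,1]$ and all $z_1,z_2\in\mathbb R^d$ with $\|z_1\|=\|z_2\|=1$ and $z_1\perp z_2$, $$\frac dk\,\mathbb E\,\Big|\,\|P_V z_1\|^2-t\,\|P_V z_2\|^2\,\Big|=\frac dk\int_{\mathcal G_{k,d}}\Big|\,\|P_V z_1\|^2-t\,\|P_V z_2\|^2\,\Big|\,d\sigma_k(V)\;\ge\;u_k .$$ -/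

import Mathlib

open MeasureTheory

noncomputable section

/-- The real Grassmann space: the `k`-dimensional linear subspaces of Euclidean `ℝ^d`. -/
def Grassmannian (k d : ℕ) : Type :=
  {V : Submodule ℝ (EuclideanSpace ℝ (Fin d)) // Module.finrank ℝ V = k}

namespace Grassmannian

variable {k d : ℕ}

/-- The orthogonal projector `P_V` onto the subspace `V`, as an operator on `ℝ^d`. -/
def proj (V : Grassmannian k d) :
    EuclideanSpace ℝ (Fin d) →L[ℝ] EuclideanSpace ℝ (Fin d) :=
  V.1.starProjection

/-- The topology obtained by identifying each subspace with its orthogonal projector. -/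
instance : TopologicalSpace (Grassmannian k d) :=
  TopologicalSpace.induced proj inferInstance

instance : MeasurableSpace (Grassmannian k d) := borel _

instance : BorelSpace (Grassmannian k d) := ⟨rfl⟩

end Grassmannian

/-- The orthogonal group `O(ℝ^d)`, i.e. the linear operators `g` on Euclidean `ℝ^d` with
`g* g = g g* = 1`, with its subspace topology and Borel sigma-algebra. -/
abbrev OrthGroup (d : ℕ) : Type :=
  unitary (EuclideanSpace ℝ (Fin d) →L[ℝ] EuclideanSpace ℝ (Fin d))

instance (d : ℕ) :
    ContinuousStar (EuclideanSpace ℝ (Fin d) →L[ℝ] EuclideanSpace ℝ (Fin d)) :=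
  ⟨(ContinuousLinearMap.adjoint (𝕜 := ℝ) (E := EuclideanSpace ℝ (Fin d))
    (F := EuclideanSpace ℝ (Fin d))).continuous⟩

instance (d : ℕ) : CompactSpace (OrthGroup d) := by
  have hc : IsCompact (unitary (EuclideanSpace ℝ (Fin d) →L[ℝ] EuclideanSpace ℝ (Fin d)) :
      Set (EuclideanSpace ℝ (Fin d) →L[ℝ] EuclideanSpace ℝ (Fin d))) := by
    refine Metric.isCompact_of_isClosed_isBounded isClosed_unitary ?_
    refine (Metric.isBounded_closedBall (x := 0) (r := 1)).subset fun g hg => ?_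
    rw [mem_closedBall_zero_iff]
    refine ContinuousLinearMap.opNorm_le_bound _ zero_le_one fun x => ?_
    have := (Unitary.linearIsometryEquiv ⟨g, hg⟩).norm_map x
    rw [one_mul]
    exact this.le
  exact isCompact_iff_compactSpace.mp hc

/-- The Haar measure on the orthogonal group, normalized to total mass `1`. -/
def orthHaar (d : ℕ) : Measure (OrthGroup d) :=
  Measure.haarMeasure ⊤

instance (d : ℕ) : IsProbabilityMeasure (orthHaar d) :=
  ⟨Measure.haarMeasure_self (K₀ := (⊤ : TopologicalSpace.PositiveCompacts (OrthGroup d)))⟩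

namespace Grassmannian

variable {k d : ℕ}

/-- The image `gV` of a subspace `V` under an orthogonal transformation `g`. -/
def rotate (g : OrthGroup d) (V : Grassmannian k d) : Grassmannian k d :=
  ⟨V.1.map (Unitary.linearIsometryEquiv g).toLinearEquiv.toLinearMap, by
    rw [LinearEquiv.finrank_map_eq]; exact V.2⟩

theorem proj_rotate (g : OrthGroup d) (V : Grassmannian k d) :
    (rotate g V).proj = g.1 * V.proj * (star g).1 := by
  ext1 x
  exact Submodule.starProjection_map_apply (Unitary.linearIsometryEquiv g) V.1 x

theorem continuous_rotate (V : Grassmannian k d) :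
    Continuous fun g : OrthGroup d => rotate g V := by
  rw [continuous_induced_rng]
  have : (proj ∘ fun g : OrthGroup d => rotate g V)
      = fun g : OrthGroup d => g.1 * V.proj * (star g).1 :=
    funext fun g => proj_rotate g V
  rw [this]
  fun_prop

/-- The coordinate subspace of `ℝ^d` spanned by the first `k` canonical basis vectors. -/
def coord (k d : ℕ) (h : k ≤ d) : Grassmannian k d :=
  ⟨Submodule.span ℝ (Set.range fun i : Fin k =>
      EuclideanSpace.single (Fin.castLE h i) (1 : ℝ)), by
    rw [finrank_span_eq_card]
    · simp
    · have := (EuclideanSpace.basisFun (Fin d) ℝ).toBasis.linearIndependent.comp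
        (Fin.castLE h) (Fin.castLE_injective h)
      simpa [Function.comp_def] using this⟩

/-- The rotation-invariant probability measure `σ_k` on the Grassmann space: the law of `gV₀`, where
`g` is Haar-distributed on the orthogonal group and `V₀` is a fixed `k`-dimensional subspace. -/
def uniform (k d : ℕ) (h : k ≤ d) : Measure (Grassmannian k d) :=
  (orthHaar d).map fun g => rotate g (coord k d h)

instance (h : k ≤ d) : IsProbabilityMeasure (uniform k d h) :=
  Measure.isProbabilityMeasure_map (continuous_rotate _).measurable.aemeasurable

end Grassmannian

end

noncomputable section

namespace Grassmannian

variable {k d : ℕ}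

/-! Write `s`, `r` for the two diagonal entries of `P_V` at the pair and `z` for the off-diagonal
one. If `t ≤ 0`, the absolute value is at least `s`, of mean `k / d`. If `t ≥ 0`, exchanging the two
vectors reduces the bound to `E|s - r|`, and rotating the pair by `π / 4` turns this into `2 E|z|`
(`integral_comp_sub`).

For `E|z|`, second and third moments suffice: `|z| ≥ 2ρz² - ρ²|z|³` for every `ρ`. Idempotence, the
trace and the `π / 4` rotation give three linear equations that determine `E z²`, of order at least
`d⁻²`. Since `z² ≤ s r`, the trace also bounds the third-order term by a multiple of `d⁻³`. Taking
`ρ` proportional to `d` gives `E|z| ≥ c_k / d`, which cancels the factor `d`. -/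

instance (d : ℕ) : (orthHaar d).IsMulLeftInvariant :=
  inferInstanceAs (Measure.haarMeasure ⊤).IsMulLeftInvariant

/-! ### Entries of the projector: equivariance, trace, idempotence -/

/-- The quadratic form `⟨P_V x, y⟩` of the orthogonal projector onto `V = g V₀`, where `V₀` is the
coordinate subspace. -/
def form (h : k ≤ d) (g : OrthGroup d) (x y : EuclideanSpace ℝ (Fin d)) : ℝ :=
  inner ℝ ((rotate g (coord k d h)).proj x) y

theorem inner_apply_eq_inner_star (g : OrthGroup d) (x y : EuclideanSpace ℝ (Fin d)) :
    inner ℝ (g.1 x) y = inner ℝ x ((star g).1 y) :=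
  (ContinuousLinearMap.adjoint_inner_right g.1 x y).symm

theorem form_eq (h : k ≤ d) (g : OrthGroup d) (x y : EuclideanSpace ℝ (Fin d)) :
    form h g x y = inner ℝ ((coord k d h).proj ((star g).1 x)) ((star g).1 y) := by
  rw [form, proj_rotate]
  exact inner_apply_eq_inner_star g _ y

theorem form_mul (h : k ≤ d) (a g : OrthGroup d) (x y : EuclideanSpace ℝ (Fin d)) :
    form h (a * g) (a.1 x) (a.1 y) = form h g x y := by
  have key : ∀ x, (star (a * g)).1 (a.1 x) = (star g).1 x := fun x => by
    have : (star (a * g) * a : OrthGroup d) = star g := by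
      rw [star_mul, mul_assoc, Unitary.star_mul_self, mul_one]
    exact congrArg (fun u : OrthGroup d => u.1 x) this
  rw [form_eq, form_eq, key, key]

@[fun_prop]
theorem continuous_form (h : k ≤ d) (x y : EuclideanSpace ℝ (Fin d)) :
    Continuous fun g => form h g x y := by
  simp only [form, proj_rotate]
  fun_prop

theorem integrable_of_continuous {f : OrthGroup d → ℝ} (hf : Continuous f) :
    Integrable f (orthHaar d) :=
  hf.integrable_of_hasCompactSupport (HasCompactSupport.of_compactSpace f)

theorem integral_add_of_continuous {f₁ f₂ : OrthGroup d → ℝ}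
    (h₁ : Continuous f₁) (h₂ : Continuous f₂) :
    ∫ g, (f₁ g + f₂ g) ∂orthHaar d = ∫ g, f₁ g ∂orthHaar d + ∫ g, f₂ g ∂orthHaar d :=
  integral_add (integrable_of_continuous h₁) (integrable_of_continuous h₂)

theorem form_eq_inner_proj (h : k ≤ d) (g : OrthGroup d) (x y : EuclideanSpace ℝ (Fin d)) :
    form h g x y =
      inner ℝ ((rotate g (coord k d h)).proj x) ((rotate g (coord k d h)).proj y) := by
  set V := rotate g (coord k d h) with hV
  have h1 := Submodule.inner_starProjection_left_eq_right V.1 (V.proj x) y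
  have h2 : V.1.starProjection (V.proj x) = V.proj x :=
    Submodule.starProjection_eq_self_iff.2 (Submodule.starProjection_apply_mem _ x)
  rwa [h2] at h1

theorem form_self (h : k ≤ d) (g : OrthGroup d) (x : EuclideanSpace ℝ (Fin d)) :
    form h g x x = ‖(rotate g (coord k d h)).proj x‖ ^ 2 := by
  rw [form_eq_inner_proj, real_inner_self_eq_norm_sq]

theorem form_self_nonneg (h : k ≤ d) (g : OrthGroup d) (x : EuclideanSpace ℝ (Fin d)) :
    0 ≤ form h g x x := by
  rw [form_self]; positivity

theorem form_comm (h : k ≤ d) (g : OrthGroup d) (x y : EuclideanSpace ℝ (Fin d)) :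
    form h g x y = form h g y x := by
  rw [form_eq_inner_proj, form_eq_inner_proj, real_inner_comm]

theorem form_sq_le (h : k ≤ d) (g : OrthGroup d) (x y : EuclideanSpace ℝ (Fin d)) :
    form h g x y ^ 2 ≤ form h g x x * form h g y y := by
  rw [form_eq_inner_proj, form_self, form_self, ← mul_pow]
  exact sq_le_sq' (neg_le_of_abs_le (abs_real_inner_le_norm _ _)) (real_inner_le_norm _ _)

theorem sum_form_self (h : k ≤ d) (g : OrthGroup d)
    (b : OrthonormalBasis (Fin d) ℝ (EuclideanSpace ℝ (Fin d))) :
    ∑ i, form h g (b i) (b i) = k := by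
  set V := rotate g (coord k d h) with hV
  have h1 := LinearMap.trace_eq_sum_inner (V.proj : _ →ₗ[ℝ] _) b
  have h2 : LinearMap.IsProj V.1 (V.proj : EuclideanSpace ℝ (Fin d) →ₗ[ℝ] _) :=
    ⟨fun x => Submodule.starProjection_apply_mem _ x,
      fun x hx => Submodule.starProjection_eq_self_iff.2 hx⟩
  rw [h2.trace, V.2] at h1
  rw [h1]
  exact Finset.sum_congr rfl fun i _ => real_inner_comm _ _

/-- Parseval for `P_V x`, whose squared norm is a diagonal entry because `P_V` is idempotent and
self-adjoint. -/
theorem sum_form_sq (h : k ≤ d) (g : OrthGroup d) (x : EuclideanSpace ℝ (Fin d))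
    (b : OrthonormalBasis (Fin d) ℝ (EuclideanSpace ℝ (Fin d))) :
    ∑ i, form h g x (b i) ^ 2 = form h g x x := by
  rw [form_self, ← b.sum_sq_inner_left]
  rfl

theorem form_add_sub (h : k ≤ d) (g : OrthGroup d) (x y : EuclideanSpace ℝ (Fin d)) (c : ℝ) :
    form h g (c • (x + y)) (c • (x - y)) = c ^ 2 * (form h g x x - form h g y y) := by
  have := form_comm h g x y
  simp only [form] at this ⊢
  simp only [map_smul, map_add, inner_smul_left, inner_smul_right, inner_add_left, inner_sub_right,
    this, RCLike.conj_to_real]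
  ring

/-! ### Orthonormal pairs and invariance of the joint law -/

/-- Two vectors of norm one that are orthogonal to each other. -/
structure IsOrthonormalPair (x y : EuclideanSpace ℝ (Fin d)) : Prop where
  norm_left : ‖x‖ = 1
  norm_right : ‖y‖ = 1
  inner_eq : inner ℝ x y = 0

namespace IsOrthonormalPair

variable {x y x' y' : EuclideanSpace ℝ (Fin d)}

theorem symm (hp : IsOrthonormalPair x y) : IsOrthonormalPair y x :=
  ⟨hp.2, hp.1, by rw [real_inner_comm]; exact hp.3⟩

theorem of_basis (b : OrthonormalBasis (Fin d) ℝ (EuclideanSpace ℝ (Fin d))) {i j : Fin d}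
    (hij : i ≠ j) : IsOrthonormalPair (b i) (b j) :=
  ⟨b.orthonormal.1 i, b.orthonormal.1 j, b.orthonormal.2 hij⟩

/-- Rotation of an orthonormal pair by an angle of `π / 4` (followed by a reflection). -/
theorem add_sub (hp : IsOrthonormalPair x y) :
    IsOrthonormalPair ((√2)⁻¹ • (x + y)) ((√2)⁻¹ • (x - y)) := by
  obtain ⟨h1, h2, h3⟩ := hp
  have h2p : (0 : ℝ) < √2 := by positivity
  have ha : ‖x + y‖ = √2 := by
    rw [← Real.sqrt_sq (norm_nonneg (x + y)), norm_add_sq_real, h1, h2, h3]; norm_num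
  have hs : ‖x - y‖ = √2 := by
    rw [← Real.sqrt_sq (norm_nonneg (x - y)), norm_sub_sq_real, h1, h2, h3]; norm_num
  refine ⟨?_, ?_, ?_⟩
  · rw [norm_smul, ha, norm_inv, Real.norm_of_nonneg h2p.le, inv_mul_cancel₀ h2p.ne']
  · rw [norm_smul, hs, norm_inv, Real.norm_of_nonneg h2p.le, inv_mul_cancel₀ h2p.ne']
  · rw [inner_smul_left, inner_smul_right, inner_add_left, inner_sub_right, inner_sub_right,
      real_inner_self_eq_norm_sq, real_inner_self_eq_norm_sq, real_inner_comm x y, h1, h2, h3]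
    simp

theorem exists_basis (hp : IsOrthonormalPair x y) {i j : Fin d} (hij : i ≠ j) :
    ∃ b : OrthonormalBasis (Fin d) ℝ (EuclideanSpace ℝ (Fin d)), b i = x ∧ b j = y := by
  classical
  let v : Fin d → EuclideanSpace ℝ (Fin d) := fun l => if l = i then x else y
  have hv : Orthonormal ℝ (({i, j} : Set (Fin d)).domRestrict v) := by
    refine ⟨?_, ?_⟩
    · rintro ⟨l, rfl | rfl⟩
      · simp [v, hp.1]
      · simp [v, hij.symm, hp.2]
    · rintro ⟨l, rfl | rfl⟩ ⟨m, rfl | rfl⟩ hlm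
      · exact absurd rfl hlm
      · simp [v, hij.symm, hp.3]
      · simp [v, hij.symm, hp.symm.3]
      · exact absurd rfl hlm
  obtain ⟨b, hb⟩ := hv.exists_orthonormalBasis_extension_of_card_eq (by simp)
  exact ⟨b, by simp [hb i, v], by simp [hb j, v, hij.symm]⟩

theorem exists_orthGroup (hd : 2 ≤ d) (hp : IsOrthonormalPair x y)
    (hp' : IsOrthonormalPair x' y') : ∃ a : OrthGroup d, a.1 x = x' ∧ a.1 y = y' := by
  have hij : (⟨0, by omega⟩ : Fin d) ≠ ⟨1, by omega⟩ := by simp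
  obtain ⟨b, rfl, rfl⟩ := hp.exists_basis hij
  obtain ⟨b', rfl, rfl⟩ := hp'.exists_basis hij
  refine ⟨Unitary.linearIsometryEquiv.symm (b.equiv b' (Equiv.refl _)), ?_, ?_⟩ <;>
  simp [Unitary.coe_symm_linearIsometryEquiv_apply]

/-- The joint law of the entries of the projector does not depend on the orthonormal pair. -/
theorem integral_form_eq (hd : 2 ≤ d) (h : k ≤ d) (hp : IsOrthonormalPair x y)
    (hp' : IsOrthonormalPair x' y') (F : ℝ → ℝ → ℝ → ℝ) :
    ∫ g, F (form h g x' x') (form h g x' y') (form h g y' y') ∂orthHaar d =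
      ∫ g, F (form h g x x) (form h g x y) (form h g y y) ∂orthHaar d := by
  obtain ⟨a, rfl, rfl⟩ := hp.exists_orthGroup hd hp'
  rw [← integral_mul_left_eq_self _ a]
  simp only [form_mul]

theorem integral_form_self (hd : 2 ≤ d) (h : k ≤ d) (hp : IsOrthonormalPair x y) :
    ∫ g, form h g x x ∂orthHaar d = k / d := by
  have hij : (⟨0, by omega⟩ : Fin d) ≠ ⟨1, by omega⟩ := by simp
  obtain ⟨b, -, -⟩ := hp.exists_basis hij
  have hb : ∀ i, ∫ g, form h g (b i) (b i) ∂orthHaar d = ∫ g, form h g x x ∂orthHaar d := by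
    intro i
    have : Nontrivial (Fin d) := ⟨_, _, hij⟩
    obtain ⟨j, hj⟩ := exists_ne i
    exact hp.integral_form_eq hd h (of_basis b hj.symm) fun s _ _ => s
  have hsum : ∑ i, ∫ g, form h g (b i) (b i) ∂orthHaar d = k := by
    rw [← integral_finsetSum _ fun i _ => integrable_of_continuous (continuous_form h _ _)]
    simp [sum_form_self]
  simp only [hb, Finset.sum_const, Finset.card_univ, Fintype.card_fin, nsmul_eq_mul] at hsum
  have hd0 : (d : ℝ) ≠ 0 := by positivity
  rw [eq_div_iff hd0, mul_comm]
  exact hsum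

/-- Completing `x` to an orthonormal basis and averaging over the other basis vectors. -/
theorem sub_one_mul_integral_form (hd : 2 ≤ d) (h : k ≤ d) (hp : IsOrthonormalPair x y)
    (F : ℝ → ℝ → ℝ → ℝ) (hF : Continuous fun p : ℝ × ℝ × ℝ => F p.1 p.2.1 p.2.2) :
    ∃ (b : OrthonormalBasis (Fin d) ℝ (EuclideanSpace ℝ (Fin d))) (i : Fin d), b i = x ∧
      ((d : ℝ) - 1) * ∫ g, F (form h g x x) (form h g x y) (form h g y y) ∂orthHaar d =
        ∫ g, ((∑ j, F (form h g x x) (form h g x (b j)) (form h g (b j) (b j)))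
          - F (form h g x x) (form h g x x) (form h g x x)) ∂orthHaar d := by
  have hij : (⟨0, by omega⟩ : Fin d) ≠ ⟨1, by omega⟩ := by simp
  obtain ⟨b, hx, -⟩ := hp.exists_basis hij
  refine ⟨b, _, hx, ?_⟩
  have hc : ∀ u v w : EuclideanSpace ℝ (Fin d),
      Integrable (fun g => F (form h g u u) (form h g u v) (form h g w w)) (orthHaar d) :=
    fun u v w => integrable_of_continuous (hF.comp
      (f := fun g => (form h g u u, form h g u v, form h g w w)) (by fun_prop))
  have hcb : ∀ j, j ≠ ⟨0, by omega⟩ →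
      ∫ g, F (form h g x x) (form h g x (b j)) (form h g (b j) (b j)) ∂orthHaar d =
        ∫ g, F (form h g x x) (form h g x y) (form h g y y) ∂orthHaar d := by
    intro j hj
    have := hp.integral_form_eq hd h (of_basis b hj.symm) F
    rwa [hx] at this
  rw [integral_sub (integrable_finsetSum _ fun j _ => hc x (b j) (b j)) (hc x x x),
    integral_finsetSum _ fun j _ => hc x (b j) (b j),
    ← Finset.add_sum_erase _ _ (Finset.mem_univ (⟨0, by omega⟩ : Fin d)), hx, add_sub_cancel_left,
    Finset.sum_congr rfl fun j hj => hcb j (Finset.ne_of_mem_erase hj), Finset.sum_const,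
    Finset.card_erase_of_mem (Finset.mem_univ _), Finset.card_univ, Fintype.card_fin,
    nsmul_eq_mul, Nat.cast_sub (by omega), Nat.cast_one]

/-! ### Relations between second and third moments -/

theorem integral_sq_form_self_add (hd : 2 ≤ d) (h : k ≤ d) (hp : IsOrthonormalPair x y) :
    ∫ g, form h g x x ^ 2 ∂orthHaar d + (d - 1) * ∫ g, form h g x y ^ 2 ∂orthHaar d = k / d := by
  obtain ⟨b, i, hi, hb⟩ := hp.sub_one_mul_integral_form hd h (fun _ z _ => z ^ 2) (by fun_prop)
  simp only [sum_form_sq] at hb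
  rw [hb, integral_sub (integrable_of_continuous (by fun_prop))
    (integrable_of_continuous (by fun_prop)), hp.integral_form_self hd h]
  ring

/-- The trace of `P_V` is `k`: multiply it by a diagonal entry and average. -/
theorem integral_sq_form_self_add_mul (hd : 2 ≤ d) (h : k ≤ d) (hp : IsOrthonormalPair x y) :
    ∫ g, form h g x x ^ 2 ∂orthHaar d
      + (d - 1) * ∫ g, form h g x x * form h g y y ∂orthHaar d = k * (k / d) := by
  obtain ⟨b, i, hi, hb⟩ := hp.sub_one_mul_integral_form hd h (fun s _ r => s * r) (by fun_prop)
  simp only [← Finset.mul_sum, sum_form_self] at hb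
  rw [hb, integral_sub (integrable_of_continuous (by fun_prop))
    (integrable_of_continuous (by fun_prop)), integral_mul_const, hp.integral_form_self hd h]
  simp only [sq]
  ring

theorem sub_one_mul_integral_sq_mul_le (hd : 2 ≤ d) (h : k ≤ d) (hp : IsOrthonormalPair x y) :
    (d - 1) * ∫ g, form h g x x ^ 2 * form h g y y ∂orthHaar d ≤
      k * ∫ g, form h g x x ^ 2 ∂orthHaar d := by
  obtain ⟨b, i, hi, hb⟩ :=
    hp.sub_one_mul_integral_form hd h (fun s _ r => s ^ 2 * r) (by fun_prop)
  simp only [← Finset.mul_sum, sum_form_self] at hb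
  rw [hb, ← integral_const_mul]
  refine integral_mono (integrable_of_continuous (by fun_prop))
    (integrable_of_continuous (by fun_prop)) fun g => ?_
  have := form_self_nonneg h g x
  have : 0 ≤ form h g x x ^ 2 * form h g x x := by positivity
  simp only
  linarith

/-- The difference of the diagonal entries has the law of twice the off-diagonal entry. -/
theorem integral_comp_sub (hd : 2 ≤ d) (h : k ≤ d) (hp : IsOrthonormalPair x y) (f : ℝ → ℝ) :
    ∫ g, f (form h g x x - form h g y y) ∂orthHaar d =
      ∫ g, f (2 * form h g x y) ∂orthHaar d := by
  rw [← hp.integral_form_eq hd h hp.add_sub fun _ z _ => f (2 * z)]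
  refine integral_congr_ae (.of_forall fun g => ?_)
  simp only [form_add_sub, inv_pow, Nat.ofNat_nonneg, Real.sq_sqrt]
  congr 1
  ring

/-- Second moments of the `π / 4` rotation identity: `E(s - r)² = 4 E z²`, expanded using `E s² = E
r²`. -/
theorem integral_sq_form_self_eq (hd : 2 ≤ d) (h : k ≤ d) (hp : IsOrthonormalPair x y) :
    ∫ g, form h g x x ^ 2 ∂orthHaar d =
      ∫ g, form h g x x * form h g y y ∂orthHaar d + 2 * ∫ g, form h g x y ^ 2 ∂orthHaar d := by
  have h1 := hp.integral_comp_sub hd h (· ^ 2)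
  have h2 := hp.integral_form_eq hd h hp.symm fun s _ _ => s ^ 2
  have hi : ∀ u v w z : EuclideanSpace ℝ (Fin d),
      Integrable (fun g => form h g u v * form h g w z) (orthHaar d) :=
    fun u v w z => integrable_of_continuous (by fun_prop)
  have h3 : (fun g => (form h g x x - form h g y y) ^ 2) = fun g =>
      form h g x x ^ 2 - 2 * (form h g x x * form h g y y) + form h g y y ^ 2 := by
    ext g; ring
  simp only [h3, mul_pow] at h1
  rw [integral_add_of_continuous (by fun_prop) (by fun_prop),
    integral_sub (integrable_of_continuous (by fun_prop))
    (integrable_of_continuous (by fun_prop)), integral_const_mul, integral_const_mul, h2] at h1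
  linarith

set_option synthInstance.maxHeartbeats 200000 in
/-- The comparison of the first absolute moment of the off-diagonal entry with its second moment
and with a mixed third moment of the diagonal entries. -/
theorem le_integral_abs_form (hd : 2 ≤ d) (h : k ≤ d) (hp : IsOrthonormalPair x y) {r : ℝ} :
    2 * r * ∫ g, form h g x y ^ 2 ∂orthHaar d
        - r ^ 2 * ∫ g, form h g x x ^ 2 * form h g y y ∂orthHaar d ≤
      ∫ g, |form h g x y| ∂orthHaar d := by
  have h2 := hp.integral_form_eq hd h hp.symm fun s _ t => s ^ 2 * t
  -- The cubic term is symmetrized in the two vectors; by exchange invariance both halves have the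
  -- same integral.
  have h3 : ∫ g, (2 * r * form h g x y ^ 2 - r ^ 2 * (1 / 2 * (form h g x x ^ 2 * form h g y y)
      + 1 / 2 * (form h g y y ^ 2 * form h g x x))) ∂orthHaar d ≤
      ∫ g, |form h g x y| ∂orthHaar d := by
    refine integral_mono (integrable_of_continuous (by fun_prop))
      (integrable_of_continuous (by fun_prop)) fun g => ?_
    have hx := form_self_nonneg h g x
    have hy := form_self_nonneg h g y
    have hz := form_sq_le h g x y
    simp only
    rw [← sq_abs] at hz ⊢
    have ha := abs_nonneg (form h g x y)
    generalize |form h g x y| = z at *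
    generalize form h g x x = s at *
    generalize form h g y y = t at *
    have hz' : z ≤ (s + t) / 2 := by
      refine abs_le_of_sq_le_sq' ?_ (by positivity) |>.2
      nlinarith [sq_nonneg (s - t)]
    have h3 : z * z ^ 2 ≤ (s + t) / 2 * (s * t) := by gcongr
    have h4 : 0 ≤ z * (1 - r * z) ^ 2 := by positivity
    have h5 := mul_le_mul_of_nonneg_left h3 (sq_nonneg r)
    nlinarith
  rw [integral_sub (integrable_of_continuous (by fun_prop))
    (integrable_of_continuous (by fun_prop)), integral_const_mul, integral_const_mul,
    integral_add_of_continuous (by fun_prop) (by fun_prop), integral_const_mul,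
    integral_const_mul, h2] at h3
  linarith

/-! ### Explicit bounds on the off-diagonal entry -/

theorem one_div_le_integral_sq_form (hk : 1 ≤ k) (hkd : k < d) (hp : IsOrthonormalPair x y) :
    1 / (4 * (d : ℝ) ^ 2) ≤ ∫ g, form hkd.le g x y ^ 2 ∂orthHaar d := by
  have hd : 2 ≤ d := by omega
  have h1 := hp.integral_sq_form_self_add hd hkd.le
  have h2 := hp.integral_sq_form_self_add_mul hd hkd.le
  have h3 := hp.integral_sq_form_self_eq hd hkd.le
  generalize ∫ g, form hkd.le g x x ^ 2 ∂orthHaar d = a at *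
  generalize ∫ g, form hkd.le g x y ^ 2 ∂orthHaar d = c at *
  generalize ∫ g, form hkd.le g x x * form hkd.le g y y ∂orthHaar d = b at *
  have hk' : (1 : ℝ) ≤ k := by exact_mod_cast hk
  have hkd' : (k : ℝ) + 1 ≤ d := by exact_mod_cast hkd
  have hd0 : (0 : ℝ) < d := by linarith
  obtain rfl : b = a - 2 * c := by linarith
  obtain rfl : a = k / d - (d - 1) * c := by linarith
  -- The exact second moment, from eliminating `a` and `b`.
  have hc : c * (d * (d - 1) * (d + 2)) = k * (d - k) := by
    field_simp at h2
    linarith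
  -- The difference of the two sides is `(k - 1)(d - k - 1)`.
  have hlow : (d : ℝ) - 1 ≤ k * (d - k) := by nlinarith
  have hc1 : 1 ≤ c * (d * (d + 2)) := by
    have : ((d : ℝ) - 1) * 1 ≤ (d - 1) * (c * (d * (d + 2))) := by linarith
    exact le_of_mul_le_mul_left this (by linarith)
  have hc0 : 0 ≤ c := by
    by_contra hneg
    push Not at hneg
    have : c * (d * (d + 2)) ≤ 0 := mul_nonpos_of_nonpos_of_nonneg hneg.le (by positivity)
    linarith
  rw [div_le_iff₀ (by positivity)]
  have h2d : (d : ℝ) * (d + 2) ≤ 4 * d ^ 2 := by nlinarith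
  exact hc1.trans (mul_le_mul_of_nonneg_left h2d hc0)

theorem integral_sq_mul_form_le (hk : 1 ≤ k) (hkd : k < d) (hp : IsOrthonormalPair x y) :
    ∫ g, form hkd.le g x x ^ 2 * form hkd.le g y y ∂orthHaar d ≤ 12 * (k : ℝ) ^ 3 / d ^ 3 := by
  have hd : 2 ≤ d := by omega
  have h2 := hp.integral_sq_form_self_add_mul hd hkd.le
  have h3 := hp.integral_sq_form_self_eq hd hkd.le
  have h4 := hp.sub_one_mul_integral_sq_mul_le hd hkd.le
  have h5 : ∫ g, form hkd.le g x y ^ 2 ∂orthHaar d ≤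
      ∫ g, form hkd.le g x x * form hkd.le g y y ∂orthHaar d :=
    integral_mono (integrable_of_continuous (by fun_prop))
      (integrable_of_continuous (by fun_prop)) fun g => form_sq_le _ g x y
  have h6 : 0 ≤ ∫ g, form hkd.le g x x ^ 2 ∂orthHaar d := integral_nonneg fun g => sq_nonneg _
  generalize ∫ g, form hkd.le g x x ^ 2 ∂orthHaar d = a at *
  generalize ∫ g, form hkd.le g x y ^ 2 ∂orthHaar d = c at *
  generalize ∫ g, form hkd.le g x x ^ 2 * form hkd.le g y y ∂orthHaar d = q at *
  generalize ∫ g, form hkd.le g x x * form hkd.le g y y ∂orthHaar d = b at *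
  have hk' : (1 : ℝ) ≤ k := by exact_mod_cast hk
  have hd2 : (2 : ℝ) ≤ d := by exact_mod_cast hd
  have hd1 : 0 < (d : ℝ) - 1 := by linarith
  -- The trace is used twice, with `a = b + 2c ≤ 3b` in between.
  have hq : (d - 1) * ((d - 1) * q) ≤ 3 * k ^ 3 / d := by
    calc (d - 1) * ((d - 1) * q) ≤ (d - 1) * (k * (3 * b)) :=
          mul_le_mul_of_nonneg_left (h4.trans (by gcongr; linarith)) hd1.le
      _ = 3 * k * ((d - 1) * b) := by ring
      _ ≤ 3 * k * (k * (k / d)) :=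
          mul_le_mul_of_nonneg_left (by linarith) (by positivity)
      _ = 3 * k ^ 3 / d := by ring
  have hdd : (d : ℝ) ^ 2 ≤ 4 * (d - 1) ^ 2 := by nlinarith
  rw [le_div_iff₀ (by positivity)]
  rw [le_div_iff₀ (by positivity)] at hq
  rcases le_total q 0 with hq0 | hq0
  · exact (mul_nonpos_of_nonpos_of_nonneg hq0 (by positivity)).trans (by positivity)
  · calc q * (d : ℝ) ^ 3 = q * d * d ^ 2 := by ring
      _ ≤ q * d * (4 * (d - 1) ^ 2) := by gcongr
      _ = 4 * ((d - 1) * ((d - 1) * q) * d) := by ring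
      _ ≤ 4 * (3 * k ^ 3) := by gcongr
      _ = 12 * (k : ℝ) ^ 3 := by ring

theorem one_div_le_integral_abs_form (hk : 1 ≤ k) (hkd : k < d) (hp : IsOrthonormalPair x y) :
    1 / (192 * (k : ℝ) ^ 3 * d) ≤ ∫ g, |form hkd.le g x y| ∂orthHaar d := by
  have hk0 : (0 : ℝ) < k := by exact_mod_cast hk
  have hd0 : (0 : ℝ) < d := by exact_mod_cast (by omega : 0 < d)
  -- This `r` maximizes `2rA - r²B` for `A = 1 / (4d²)`, `B = 12k³ / d³`; the maximum is `A² / B`.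
  refine le_trans ?_ (hp.le_integral_abs_form (by omega) hkd.le (r := d / (48 * k ^ 3)))
  have h1 := mul_le_mul_of_nonneg_left (hp.one_div_le_integral_sq_form hk hkd)
    (by positivity : (0 : ℝ) ≤ 2 * (d / (48 * k ^ 3)))
  have h2 := mul_le_mul_of_nonneg_left (hp.integral_sq_mul_form_le hk hkd)
    (sq_nonneg ((d : ℝ) / (48 * k ^ 3)))
  have h3 : 1 / (192 * (k : ℝ) ^ 3 * d) = 2 * (d / (48 * k ^ 3)) * (1 / (4 * (d : ℝ) ^ 2))
      - (d / (48 * k ^ 3)) ^ 2 * (12 * (k : ℝ) ^ 3 / d ^ 3) := by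
    field_simp
    norm_num
  linarith

/-! ### From the off-diagonal entry to the weighted difference -/

set_option synthInstance.maxHeartbeats 200000 in
theorem integral_abs_form_le (hd : 2 ≤ d) (h : k ≤ d) (hp : IsOrthonormalPair x y) {t : ℝ}
    (ht : 0 ≤ t) :
    ∫ g, |form h g x y| ∂orthHaar d ≤ ∫ g, |form h g x x - t * form h g y y| ∂orthHaar d := by
  have h1 := hp.integral_comp_sub hd h fun s => |s|
  have h2 := hp.integral_form_eq hd h hp.symm fun s _ r => |s - t * r|
  simp only [abs_mul, abs_two] at h1
  rw [integral_const_mul] at h1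
  have h3 : ∫ g, |form h g x x - form h g y y| ∂orthHaar d ≤
      ∫ g, (|form h g x x - t * form h g y y| + |form h g y y - t * form h g x x|)
        ∂orthHaar d := by
    refine integral_mono (integrable_of_continuous (by fun_prop))
      (integrable_of_continuous (by fun_prop)) fun g => ?_
    simp only
    set s := form h g x x
    set r := form h g y y
    have h4 := abs_sub (s - t * r) (r - t * s)
    -- The factor `1 + t ≥ 1` can then be dropped.
    rw [show s - t * r - (r - t * s) = (1 + t) * (s - r) by ring, abs_mul,
      abs_of_nonneg (by linarith : 0 ≤ 1 + t)] at h4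
    nlinarith [abs_nonneg (s - r)]
  rw [integral_add_of_continuous (by fun_prop) (by fun_prop), h2] at h3
  linarith

theorem one_div_le_integral_abs_sub (hk : 1 ≤ k) (hkd : k < d) (hp : IsOrthonormalPair x y)
    (t : ℝ) : 1 / (192 * (k : ℝ) ^ 3 * d) ≤
      ∫ g, |form hkd.le g x x - t * form hkd.le g y y| ∂orthHaar d := by
  rcases le_total 0 t with ht | ht
  · exact (hp.one_div_le_integral_abs_form hk hkd).trans
      (hp.integral_abs_form_le (by omega) hkd.le ht)
  · have hk' : (1 : ℝ) ≤ k := by exact_mod_cast hk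
    have hd0 : (0 : ℝ) < d := by exact_mod_cast (by omega : 0 < d)
    calc 1 / (192 * (k : ℝ) ^ 3 * d) ≤ k / d := by
          rw [div_le_div_iff₀ (by positivity) hd0]
          have : 1 ≤ (k : ℝ) * (192 * k ^ 3) := by
            have := one_le_pow₀ (n := 4) hk'
            nlinarith
          nlinarith
      _ = ∫ g, form hkd.le g x x ∂orthHaar d := (hp.integral_form_self (by omega) hkd.le).symm
      _ ≤ _ := by
          refine integral_mono (integrable_of_continuous (by fun_prop))
            (integrable_of_continuous (by fun_prop)) fun g => ?_
          have := mul_nonneg_of_nonpos_of_nonpos ht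
            (neg_nonpos.2 (form_self_nonneg hkd.le g y))
          exact le_trans (by linarith) (le_abs_self _)

end IsOrthonormalPair

/-! ### Transfer to the Grassmannian and conclusion -/

theorem continuous_proj : Continuous (proj : Grassmannian k d → _) := continuous_induced_dom

theorem integral_uniform (h : k ≤ d) (t : ℝ) (x y : EuclideanSpace ℝ (Fin d)) :
    ∫ V : Grassmannian k d, |‖V.proj x‖ ^ 2 - t * ‖V.proj y‖ ^ 2| ∂uniform k d h =
      ∫ g, |form h g x x - t * form h g y y| ∂orthHaar d := by
  have hc : Continuous fun V : Grassmannian k d => |‖V.proj x‖ ^ 2 - t * ‖V.proj y‖ ^ 2| := by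
    have := continuous_proj (k := k) (d := d)
    fun_prop
  rw [uniform, integral_map (continuous_rotate _).measurable.aemeasurable
    hc.aestronglyMeasurable]
  simp only [form_self]

end Grassmannian

end

theorem proposition5p7 (k : ℕ) (hk : 1 ≤ k) :
    ∃ u : ℝ, 0 < u ∧ ∀ (d : ℕ) (hkd : k < d) (t : ℝ), t ∈ Set.Icc (-1 : ℝ) 1 →
      ∀ z₁ z₂ : EuclideanSpace ℝ (Fin d), ‖z₁‖ = 1 → ‖z₂‖ = 1 → inner ℝ z₁ z₂ = 0 →
        u ≤ (d : ℝ) / (k : ℝ) *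
          ∫ V : Grassmannian k d, |‖V.proj z₁‖ ^ 2 - t * ‖V.proj z₂‖ ^ 2|
            ∂(Grassmannian.uniform k d hkd.le) := by
  have hk0 : (0 : ℝ) < k := by exact_mod_cast hk
  refine ⟨1 / (192 * (k : ℝ) ^ 4), by positivity, fun d hkd t _ z₁ z₂ h₁ h₂ h₁₂ => ?_⟩
  have hd0 : (0 : ℝ) < d := by exact_mod_cast (by omega : 0 < d)
  have hp : Grassmannian.IsOrthonormalPair z₁ z₂ := ⟨h₁, h₂, h₁₂⟩
  rw [Grassmannian.integral_uniform]
  calc 1 / (192 * (k : ℝ) ^ 4) = d / k * (1 / (192 * (k : ℝ) ^ 3 * d)) := by field_simp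
    _ ≤ _ := by
      gcongr
      exact hp.one_div_le_integral_abs_sub hk hkd t
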